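/- Let $X$ be a real or complex Banach space with closed unit ball $B_X=\{x\in X:\|x\|\le 1\}$ and dual space $X^*$, and let $\{x_n\}_{n\in\mathbb N}\subset B_X$ be a sequence that is not relatively norm-compact, i.e. the norm closure of the set $\{x_n : n\in\mathbb N\}$ is not compact. Then there exists an infinite-dimensional closed linear subspace $Y$ of $X^*$ such that the set $\{x_n : n\in\mathbb N\}\cap Y^{\top}$ is infinite, where $Y^{\top}=\{x\in X : f(x)=0 \text{ for all } f\in Y\}$ is the preannihilator of $Y$. In particular, the same conclusion holds for every sequence $\{x_n\}_{n\in\mathbb N}\subset B_X$ that is $\delta$-separated for some $\delta>0$, i.e. satisfies $\|x_m-x_n\|\ge\delta$ whenever $m\ne n$. -/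

import Mathlib

/-- The preannihilator (annihilator in `X`) of a subspace `Y` of the dual space `X*`:
all `x` in `X` at which every functional of `Y` vanishes. -/
def preannihilator {𝕜 X : Type*} [RCLike 𝕜] [NormedAddCommGroup X] [NormedSpace 𝕜 X]
    (Y : Submodule 𝕜 (StrongDual 𝕜 X)) : Submodule 𝕜 X where
  carrier := {x | ∀ f ∈ Y, f x = 0}
  add_mem' := fun ha hb f hf => by rw [map_add, ha f hf, hb f hf, add_zero]
  zero_mem' := fun f _ => map_zero f
  smul_mem' := fun c x hx f hf => by rw [map_smul, hx f hf, smul_zero]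

/-! If the range of `x` is not totally bounded, it carries an ultrafilter that is not Cauchy. In the
bidual that ultrafilter has a weak* limit `G`, whether or not `G` comes from `X`, and the
differences `x n - G` are weak*-null but bounded away from `0` in norm. Mazur's technique then
selects terms `G + e k` with `e k` almost orthogonal to `G` and the earlier `e i`, so each selected
term keeps a fixed distance from the span of the others. Let `Y` be the annihilator of the
even-indexed selected terms: they lie in its preannihilator. By Hahn-Banach the unit ball of `Y`
still separates the odd-indexed ones uniformly, which compactness forbids if `Y` is
finite-dimensional. -/

open Filter Topology in
/-- Mazur's lemma: let `φ` be a norming family of functionals. Vectors that tend to `0` at each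
`φ a` along an ultrafilter and stay bounded away from `0` in norm become almost orthogonal to any
given finite-dimensional subspace. -/
theorem eventually_mul_norm_le_norm_add_smul {𝕜 V ι α : Type*} [RCLike 𝕜] [NormedAddCommGroup V]
    [NormedSpace 𝕜 V] (φ : α → V →L[𝕜] 𝕜) (hφ : ∀ a v, ‖φ a v‖ ≤ ‖v‖)
    (hφ' : ∀ v r, 0 ≤ r → (∀ a, ‖φ a v‖ ≤ r) → ‖v‖ ≤ r) (U : Ultrafilter ι) (d : ι → V)
    (hd : ∀ a, Tendsto (fun n => φ a (d n)) U (𝓝 0)) {c : ℝ} (hc : 0 < c)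
    (hdc : ∀ᶠ n in (U : Filter ι), c ≤ ‖d n‖) (E : Submodule 𝕜 V)
    [FiniteDimensional 𝕜 E] {r : ℝ} (hr0 : 0 < r) (hr : r < 1) :
    ∀ᶠ n in (U : Filter ι), ∀ u ∈ E, ∀ t : 𝕜, r * ‖u‖ ≤ ‖u + t • d n‖ := by
  by_contra hcon
  rw [← Ultrafilter.eventually_not] at hcon
  have key : ∀ᶠ n in (U : Filter ι), ∃ p : E × 𝕜, ‖p.1‖ = 1 ∧ ‖p.2‖ ≤ 2 / c ∧
      ‖(p.1 : V) + p.2 • d n‖ ≤ r := by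
    filter_upwards [hcon, hdc] with n hn hcn
    push Not at hn
    obtain ⟨u, hu, t, ht⟩ := hn
    have hu0 : 0 < ‖u‖ := by
      by_contra h
      have h0 : ‖u‖ = 0 := le_antisymm (not_lt.1 h) (norm_nonneg _)
      rw [h0, mul_zero] at ht
      exact absurd ht (not_lt.2 (norm_nonneg _))
    have hnorm : ‖((‖u‖⁻¹ : ℝ) : 𝕜)‖ = ‖u‖⁻¹ := by simp
    have h1 : ‖((‖u‖⁻¹ : ℝ) : 𝕜) • u‖ = 1 := by
      rw [norm_smul, hnorm, inv_mul_cancel₀ hu0.ne']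
    have h2 : ‖((‖u‖⁻¹ : ℝ) : 𝕜) • u + (((‖u‖⁻¹ : ℝ) : 𝕜) * t) • d n‖ ≤ r := by
      rw [mul_smul, ← smul_add, norm_smul, hnorm, inv_mul_le_iff₀ hu0, mul_comm]
      exact ht.le
    refine ⟨⟨⟨((‖u‖⁻¹ : ℝ) : 𝕜) • u, E.smul_mem _ hu⟩, ((‖u‖⁻¹ : ℝ) : 𝕜) * t⟩, h1, ?_, h2⟩
    -- `‖a‖ * c ≤ ‖a • d n‖ ≤ r + 1 < 2`, so the coefficients stay in a compact ball.
    set a := ((‖u‖⁻¹ : ℝ) : 𝕜) * t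
    set w := ((‖u‖⁻¹ : ℝ) : 𝕜) • u
    have h3 : ‖a • d n‖ ≤ ‖w + a • d n‖ + ‖w‖ := by
      simpa using norm_sub_le (w + a • d n) w
    rw [norm_smul] at h3
    change ‖a‖ ≤ _
    rw [le_div_iff₀ hc]
    nlinarith [mul_le_mul_of_nonneg_left hcn (norm_nonneg a)]
  obtain ⟨p, hp⟩ := key.choice
  have : ProperSpace E := FiniteDimensional.proper_rclike 𝕜 E
  obtain ⟨e, he, hpe⟩ := (isCompact_sphere (0 : E) 1).ultrafilter_le_nhds
    (U.map fun n => (p n).1) (by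
      rw [Ultrafilter.coe_map, le_principal_iff, mem_map]
      filter_upwards [hp] with n hn
      simpa using hn.1)
  obtain ⟨t, -, hpt⟩ := (isCompact_closedBall (0 : 𝕜) (2 / c)).ultrafilter_le_nhds
    (U.map fun n => (p n).2) (by
      rw [Ultrafilter.coe_map, le_principal_iff, mem_map]
      filter_upwards [hp] with n hn
      simpa using hn.2.1)
  have hpe' : Tendsto (fun n => (p n).1) U (𝓝 e) := hpe
  have hpt' : Tendsto (fun n => (p n).2) U (𝓝 t) := hpt
  have he1 : ‖(e : V)‖ = 1 := by simpa using he
  -- In the limit each `φ a` kills the `d n` term, so the unit vector `e` would have norm at most `r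
  -- < 1`.
  have hle : ‖(e : V)‖ ≤ r := by
    refine hφ' _ _ hr0.le fun a => ?_
    have hlim : Tendsto (fun n => ‖φ a (((p n).1 : V) + (p n).2 • d n)‖) U
        (𝓝 ‖φ a (e : V) + t • 0‖) := by
      have hev : Continuous fun g : E => φ a (g : V) := by fun_prop
      simp only [map_add, map_smul]
      exact (((hev.tendsto e).comp hpe').add (hpt'.smul (hd a))).norm
    rw [smul_zero, add_zero] at hlim
    refine le_of_tendsto hlim ?_
    filter_upwards [hp] with n hn
    exact (hφ a _).trans hn.2.2
  linarith

/-! ### Almost orthogonal sequences -/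

/-- Recursive choice of vectors relative to the finite-dimensional subspaces spanned so far. -/
theorem exists_seq_finiteDimensional {𝕜 V ι : Type*} [Field 𝕜] [AddCommGroup V] [Module 𝕜 V]
    (d : ι → V) (v : V) (Q : ℕ → Submodule 𝕜 V → ι → Prop)
    (hQ : ∀ k (E : Submodule 𝕜 V), FiniteDimensional 𝕜 E → ∃ n, Q k E n) :
    ∃ (E : ℕ → Submodule 𝕜 V) (n : ℕ → ι), Monotone E ∧ v ∈ E 0 ∧
      (∀ k, d (n k) ∈ E (k + 1)) ∧ ∀ k, Q k (E k) (n k) := by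
  choose g hg using hQ
  let F : ℕ → {E : Submodule 𝕜 V // FiniteDimensional 𝕜 E} := fun k =>
    Nat.rec ⟨Submodule.span 𝕜 {v}, inferInstance⟩
      (fun k E => ⟨E.1 ⊔ Submodule.span 𝕜 {d (g k E.1 E.2)}, by
        have := E.2
        infer_instance⟩) k
  refine ⟨fun k => (F k).1, fun k => g k (F k).1 (F k).2, monotone_nat_of_le_succ fun k => ?_,
    Submodule.mem_span_singleton_self v, fun k => ?_, fun k => hg k _ _⟩
  · exact le_sup_left (b := Submodule.span 𝕜 {d (g k (F k).1 (F k).2)})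
  · exact Submodule.mem_sup_right (S := (F k).1) (Submodule.mem_span_singleton_self _)

/-- Stepwise almost-orthogonality estimates with telescoping constants multiply up. -/
theorem mul_norm_le_mul_norm_add_of_mem_span {𝕜 V : Type*} [NormedField 𝕜]
    [SeminormedAddCommGroup V] [NormedSpace 𝕜 V] {E : ℕ → Submodule 𝕜 V} {e : ℕ → V} {w : ℕ → ℝ}
    (hE : Monotone E) (he : ∀ k, e k ∈ E (k + 1)) (hw : ∀ k, 0 < w k)
    (h : ∀ k, ∀ u ∈ E k, ∀ t : 𝕜, w (k + 1) * ‖u‖ ≤ w k * ‖u + t • e k‖) (j m : ℕ)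
    {u v : V} (hu : u ∈ E j) (hv : v ∈ Submodule.span 𝕜 (e '' Set.Ico j (j + m))) :
    w (j + m) * ‖u‖ ≤ w j * ‖u + v‖ := by
  induction m generalizing v with
  | zero =>
    have : v = 0 := by simpa using hv
    simp [this]
  | succ m ih =>
    have hI : Set.Ico j (j + (m + 1)) = insert (j + m) (Set.Ico j (j + m)) := by
      ext i; simp only [Set.mem_Ico, Set.mem_insert_iff]; omega
    rw [hI, Set.image_insert_eq, Submodule.mem_span_insert] at hv
    obtain ⟨t, v', hv', rfl⟩ := hv
    have hmem : v' ∈ E (j + m) := by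
      refine Submodule.span_le.2 ?_ hv'
      rintro _ ⟨i, hi, rfl⟩
      exact hE (Nat.succ_le_of_lt hi.2) (he i)
    have h1 := h (j + m) (u + v') ((E _).add_mem (hE (Nat.le_add_right j m) hu) hmem) t
    have h2 := ih hv'
    rw [show u + (t • e (j + m) + v') = u + v' + t • e (j + m) by abel]
    refine le_of_mul_le_mul_left ?_ (hw (j + m))
    calc w (j + m) * (w (j + (m + 1)) * ‖u‖) = w (j + m + 1) * (w (j + m) * ‖u‖) := by
          rw [← add_assoc]; ring
      _ ≤ w (j + m + 1) * (w j * ‖u + v'‖) := mul_le_mul_of_nonneg_left h2 (hw _).le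
      _ = w j * (w (j + m + 1) * ‖u + v'‖) := by ring
      _ ≤ w j * (w (j + m) * ‖u + v' + t • e (j + m)‖) :=
          mul_le_mul_of_nonneg_left h1 (hw _).le
      _ = _ := by ring

theorem exists_mem_span_image_Ico {𝕜 V : Type*} [Semiring 𝕜] [AddCommMonoid V] [Module 𝕜 V]
    (e : ℕ → V) (j : ℕ) {v : V} (hv : v ∈ Submodule.span 𝕜 (e '' Set.Ici j)) :
    ∃ m, v ∈ Submodule.span 𝕜 (e '' Set.Ico j (j + m)) := by
  have hmono : ∀ {a b : ℕ}, a ≤ b → Submodule.span 𝕜 (e '' Set.Ico j (j + a)) ≤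
      Submodule.span 𝕜 (e '' Set.Ico j (j + b)) := fun hab =>
    Submodule.span_mono (Set.image_mono (Set.Ico_subset_Ico_right (by omega)))
  induction hv using Submodule.span_induction with
  | mem x hx =>
    obtain ⟨i, hi, rfl⟩ := hx
    have hi' : j ≤ i := hi
    exact ⟨i + 1, Submodule.subset_span ⟨i, ⟨hi', by omega⟩, rfl⟩⟩
  | zero => exact ⟨0, Submodule.zero_mem _⟩
  | add x y _ _ hx hy =>
    obtain ⟨a, ha⟩ := hx
    obtain ⟨b, hb⟩ := hy
    exact ⟨max a b, Submodule.add_mem _ (hmono (le_max_left a b) ha)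
      (hmono (le_max_right a b) hb)⟩
  | smul t x _ hx =>
    obtain ⟨a, ha⟩ := hx
    exact ⟨a, Submodule.smul_mem _ t ha⟩

/-- Each member of a sequence `z k = v + e k` with `e` almost orthogonal to the preceding terms
and to `v` keeps a uniform distance from the span of the others. -/
theorem div_six_le_norm_sub_of_mem_span {𝕜 V : Type*} [NormedField 𝕜]
    [SeminormedAddCommGroup V] [NormedSpace 𝕜 V] {E : ℕ → Submodule 𝕜 V} {e z : ℕ → V} {v : V}
    {w : ℕ → ℝ} (hE : Monotone E) (hv : v ∈ E 0) (he : ∀ k, e k ∈ E (k + 1))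
    (hw : ∀ k, 1 ≤ w k) (hw2 : ∀ k, w k ≤ 2)
    (h : ∀ k, ∀ u ∈ E k, ∀ t : 𝕜, w (k + 1) * ‖u‖ ≤ w k * ‖u + t • e k‖)
    (hz : ∀ k, z k = v + e k) {c : ℝ} (hc : ∀ k, c ≤ ‖e k‖) (j : ℕ) {s : V}
    (hs : s ∈ Submodule.span 𝕜 (z '' {j}ᶜ)) : c / 6 ≤ ‖z j - s‖ := by
  have hvE : ∀ k, v ∈ E k := fun k => hE (Nat.zero_le k) hv
  -- The shift `v` lies in every `E k`, so only the later `e i` remain outside `E j`.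
  have hs' : s ∈ E j ⊔ Submodule.span 𝕜 (e '' Set.Ici (j + 1)) := by
    refine Submodule.span_le.2 ?_ hs
    rintro _ ⟨i, hi, rfl⟩
    rw [SetLike.mem_coe, hz]
    refine Submodule.add_mem _ (Submodule.mem_sup_left (hvE j)) ?_
    rcases lt_or_gt_of_ne (show i ≠ j from hi) with hij | hij
    · exact Submodule.mem_sup_left (hE (Nat.succ_le_of_lt hij) (he i))
    · exact Submodule.mem_sup_right (Submodule.subset_span ⟨i, Nat.succ_le_of_lt hij, rfl⟩)
  obtain ⟨a, ha, b, hb, rfl⟩ := Submodule.mem_sup.1 hs'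
  obtain ⟨m, hm⟩ := exists_mem_span_image_Ico e (j + 1) hb
  have hu : v - a ∈ E j := (E j).sub_mem (hvE j) ha
  have h1 := mul_norm_le_mul_norm_add_of_mem_span hE he (fun k => zero_lt_one.trans_le (hw k)) h
    (j + 1) m ((E (j + 1)).add_mem (hE (Nat.le_succ j) hu) (he j)) (Submodule.neg_mem _ hm)
  have h2 := h j (v - a) hu 1
  rw [one_smul] at h2
  rw [hz, show v + e j - (a + b) = v - a + e j + -b by abel]
  -- The constant 6 is 3 from this inequality with `h5`, times 2 from `h6`.
  have h3 : ‖e j‖ ≤ ‖v - a + e j‖ + ‖v - a‖ := by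
    simpa using norm_sub_le (v - a + e j) (v - a)
  have h4 := hc j
  have h5 : ‖v - a‖ ≤ 2 * ‖v - a + e j‖ := by
    nlinarith [hw (j + 1), hw2 j, norm_nonneg (v - a), norm_nonneg (v - a + e j)]
  have h6 : ‖v - a + e j‖ ≤ 2 * ‖v - a + e j + -b‖ := by
    nlinarith [hw (j + 1 + m), hw2 (j + 1), norm_nonneg (v - a + e j + -b),
      norm_nonneg (v - a + e j)]
  linarith

/-! ### Extraction of a uniformly minimal subsequence -/

open Filter Topology in
/-- A non-Cauchy ultrafilter on the range of a sequence which has a limit `G` against a norming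
family of functionals yields a subsequence whose terms keep a uniform distance from the span of
the others. -/
theorem exists_uniformly_minimal_subseq_of_tendsto {𝕜 X V α : Type*} [RCLike 𝕜]
    [NormedAddCommGroup X] [NormedSpace 𝕜 X] [NormedAddCommGroup V] [NormedSpace 𝕜 V]
    (φ : α → V →L[𝕜] 𝕜) (hφ : ∀ a v, ‖φ a v‖ ≤ ‖v‖)
    (hφ' : ∀ v r, 0 ≤ r → (∀ a, ‖φ a v‖ ≤ r) → ‖v‖ ≤ r) (J : X →ₗᵢ[𝕜] V) (x : ℕ → X)
    (U : Ultrafilter ℕ) (hU : ¬ Cauchy (U.map x : Filter X)) (G : V)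
    (hG : ∀ a, Tendsto (fun n => φ a (J (x n) - G)) U (𝓝 0)) :
    ∃ (n : ℕ → ℕ) (c : ℝ), 0 < c ∧
      ∀ j, ∀ s ∈ Submodule.span 𝕜 ((x ∘ n) '' {j}ᶜ), c ≤ ‖x (n j) - s‖ := by
  -- Otherwise `J (x n)` tends to `G` in norm along `U`, and since `J` is isometric the image of `U`
  -- under `x` is Cauchy.
  obtain ⟨c, hc, hdc⟩ : ∃ c : ℝ, 0 < c ∧ ∀ᶠ n in (U : Filter ℕ), c ≤ ‖J (x n) - G‖ := by
    by_contra! hcon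
    refine hU (Metric.cauchy_iff.2 ⟨(U.map x).neBot, fun ε hε => ?_⟩)
    have h1 := hcon (ε / 2) (half_pos hε)
    refine ⟨{y | ‖J y - G‖ < ε / 2}, ?_, fun y hy z hz => ?_⟩
    · exact h1
    · rw [← J.dist_map, dist_eq_norm, show J y - J z = (J y - G) - (J z - G) by abel]
      have := norm_sub_le (J y - G) (J z - G)
      have hy' : ‖J y - G‖ < ε / 2 := hy
      have hz' : ‖J z - G‖ < ε / 2 := hz
      linarith
  -- Decreasing within `[1, 2]`: each ratio `w (k + 1) / w k` is below 1, as Mazur's lemma requires,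
  -- yet their products telescope and stay at least 1/2.
  let w : ℕ → ℝ := fun k => 1 + 1 / ((k : ℝ) + 1)
  have hw : ∀ k, 1 ≤ w k := fun k => by
    have : 0 ≤ 1 / ((k : ℝ) + 1) := by positivity
    simp only [w]; linarith
  have hw2 : ∀ k, w k ≤ 2 := fun k => by
    have : 1 / ((k : ℝ) + 1) ≤ 1 := by
      rw [div_le_one (by positivity)]
      linarith [Nat.cast_nonneg (α := ℝ) k]
    simp only [w]; linarith
  have hwlt : ∀ k, w (k + 1) < w k := fun k => by
    simp only [w]
    have := Nat.one_div_lt_one_div (α := ℝ) (Nat.lt_succ_self k)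
    push_cast at this ⊢
    linarith
  have hwpos : ∀ k, 0 < w k := fun k => zero_lt_one.trans_le (hw k)
  obtain ⟨E, n, hE, hGE, he, hQ⟩ := exists_seq_finiteDimensional (𝕜 := 𝕜)
    (fun n => J (x n) - G) G
    (fun k E n => (∀ u ∈ E, ∀ t : 𝕜, w (k + 1) / w k * ‖u‖ ≤ ‖u + t • (J (x n) - G)‖) ∧
      c ≤ ‖J (x n) - G‖) (fun k E hE =>
      ((eventually_mul_norm_le_norm_add_smul φ hφ hφ' U _ hG hc hdc E (div_pos (hwpos _) (hwpos k))
        ((div_lt_one (hwpos k)).2 (hwlt k))).and hdc).exists)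
  refine ⟨n, c / 6, by positivity, fun j s hs => ?_⟩
  rw [← J.norm_map, map_sub]
  refine div_six_le_norm_sub_of_mem_span (𝕜 := 𝕜) (z := fun k => J (x (n k))) hE hGE he hw hw2
    (fun k u hu t => ?_) (fun k => (add_sub_cancel G _).symm) (fun k => (hQ k).2) j ?_
  · have := (hQ k).1 u hu t
    rwa [div_mul_eq_mul_div, div_le_iff₀' (hwpos k)] at this
  · have := Submodule.mem_map_of_mem (f := J.toLinearMap) hs
    rw [Submodule.map_span, ← Set.image_comp] at this
    exact this

open Filter Topology in
/-- A bounded sequence that is not totally bounded has a subsequence whose terms keep a uniform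
distance from the span of the others. -/
theorem exists_uniformly_minimal_subseq {𝕜 X : Type*} [RCLike 𝕜] [NormedAddCommGroup X]
    [NormedSpace 𝕜 X] (x : ℕ → X) (hx : ∀ n, ‖x n‖ ≤ 1)
    (hnt : ¬ TotallyBounded (Set.range x)) :
    ∃ (n : ℕ → ℕ) (c : ℝ), 0 < c ∧
      ∀ j, ∀ s ∈ Submodule.span 𝕜 ((x ∘ n) '' {j}ᶜ), c ≤ ‖x (n j) - s‖ := by
  rw [totallyBounded_iff_ultrafilter] at hnt
  push Not at hnt
  obtain ⟨T, hT, hTc⟩ := hnt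
  let U : Ultrafilter ℕ := T.ofComapInfPrincipal (m := x) (s := Set.univ) (by
    rw [Set.image_univ]; exact le_principal_iff.1 hT)
  have hUT : U.map x = T := Ultrafilter.ofComapInfPrincipal_eq_of_map _
  let J := NormedSpace.inclusionInDoubleDualLi (E := X) 𝕜
  obtain ⟨F, -, hF⟩ := (WeakDual.isCompact_closedBall (𝕜 := 𝕜) (E := StrongDual 𝕜 X)
      (0 : StrongDual 𝕜 (StrongDual 𝕜 X)) 1).ultrafilter_le_nhds
    (U.map fun n => StrongDual.toWeakDual (J (x n))) (by
      rw [Ultrafilter.coe_map, le_principal_iff, mem_map]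
      filter_upwards with n
      change J (x n) ∈ Metric.closedBall 0 1
      have h := J.dist_map (x n) 0
      rw [J.map_zero, dist_zero_right] at h
      exact h.trans_le (hx n))
  refine exists_uniformly_minimal_subseq_of_tendsto (V := StrongDual 𝕜 (StrongDual 𝕜 X))
    (α := Metric.closedBall (0 : StrongDual 𝕜 X) 1)
    (fun f => ContinuousLinearMap.apply 𝕜 𝕜 (f : StrongDual 𝕜 X)) (fun f v => ?_)
    (fun v r hr h => ?_) J x U (by rwa [hUT]) (WeakDual.toStrongDual F) fun f => ?_
  · exact (v.le_opNorm _).trans (mul_le_of_le_one_right (norm_nonneg _)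
      (mem_closedBall_zero_iff.1 f.2))
  · refine ContinuousLinearMap.opNorm_le_bound _ hr fun f => ?_
    exact LinearMap.bound_of_ball_bound' zero_lt_one r v.toLinearMap (fun f hf => h ⟨f, hf⟩) f
      |>.trans_eq (by rw [div_one])
  · have h1 : Tendsto (fun n => J (x n) (f : StrongDual 𝕜 X)) U (𝓝 (F (f : StrongDual 𝕜 X))) :=
      ((WeakDual.eval_continuous (f : StrongDual 𝕜 X)).tendsto F).comp hF
    have h2 := h1.sub_const (F (f : StrongDual 𝕜 X))
    rw [sub_self] at h2
    exact h2

/-! ### Annihilators and the construction of `Y` -/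

/-- The annihilator in the dual space of a set of vectors. -/
def dualAnnihilatorOfSet (𝕜 : Type*) {X : Type*} [RCLike 𝕜] [NormedAddCommGroup X]
    [NormedSpace 𝕜 X] (A : Set X) : Submodule 𝕜 (StrongDual 𝕜 X) where
  carrier := {f | ∀ a ∈ A, f a = 0}
  add_mem' := fun hf hg a ha => by
    rw [add_apply, hf a ha, hg a ha, add_zero]
  zero_mem' := fun _ _ => rfl
  smul_mem' := fun c f hf a ha => by
    rw [smul_apply, hf a ha, smul_zero]

theorem isClosed_dualAnnihilatorOfSet (𝕜 : Type*) {X : Type*} [RCLike 𝕜] [NormedAddCommGroup X]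
    [NormedSpace 𝕜 X] (A : Set X) :
    IsClosed (dualAnnihilatorOfSet 𝕜 A : Set (StrongDual 𝕜 X)) := by
  have : (dualAnnihilatorOfSet 𝕜 A : Set (StrongDual 𝕜 X)) = ⋂ a ∈ A, {f | f a = 0} := by
    ext f
    simp only [Set.mem_iInter]
    rfl
  rw [this]
  exact isClosed_biInter fun a _ => isClosed_eq (by fun_prop) continuous_const

/-- A vector at distance at least `c` from the span of `A` is detected up to `c` by a functional
in the unit ball of the annihilator of `A`. -/
theorem exists_mem_dualAnnihilatorOfSet {𝕜 X : Type*} [RCLike 𝕜] [NormedAddCommGroup X]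
    [NormedSpace 𝕜 X] (A : Set X) {v : X} {c : ℝ}
    (hv : ∀ s ∈ Submodule.span 𝕜 A, c ≤ ‖v - s‖) :
    ∃ f ∈ dualAnnihilatorOfSet 𝕜 A, ‖f‖ ≤ 1 ∧ c ≤ ‖f v‖ := by
  let S := (Submodule.span 𝕜 A).topologicalClosure
  have hS : IsClosed (S : Set X) := Submodule.isClosed_topologicalClosure _
  -- Functionals on the quotient by the closed span are those that vanish on `A`, and the quotient
  -- norm is the distance to the span.
  obtain ⟨g, hg1, hgv⟩ := exists_dual_vector'' 𝕜 (S.mkQ v)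
  have hcv : c ≤ ‖S.mkQ v‖ := by
    refine le_of_forall_pos_le_add fun ε hε => ?_
    obtain ⟨y, hy, hyn⟩ := Submodule.Quotient.norm_mk_lt (S.mkQ v) hε
    have hvy : v - y ∈ S := (Submodule.Quotient.eq S).1 hy.symm
    have hcl : v - y ∈ closure ((Submodule.span 𝕜 A : Submodule 𝕜 X) : Set X) := hvy
    have : c ≤ ‖v - (v - y)‖ :=
      closure_minimal (t := {s | c ≤ ‖v - s‖}) (fun s hs => hv s hs)
        (isClosed_le continuous_const (by fun_prop)) hcl
    rw [sub_sub_cancel] at this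
    exact this.trans hyn.le
  refine ⟨LinearMap.mkContinuous (g.toLinearMap ∘ₗ S.mkQ) 1 fun y => ?_, fun a ha => ?_, ?_, ?_⟩
  · exact (g.le_opNorm _).trans (mul_le_mul hg1 (Submodule.Quotient.norm_mk_le S y)
      (norm_nonneg _) zero_le_one)
  · have haS : a ∈ S := Submodule.le_topologicalClosure _ (Submodule.subset_span ha)
    have : S.mkQ a = 0 := (Submodule.Quotient.mk_eq_zero S).2 haS
    simp [this]
  · exact LinearMap.mkContinuous_norm_le _ zero_le_one _
  · change c ≤ ‖g (S.mkQ v)‖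
    rw [hgv]
    simpa using hcv

/-- A bounded sequence of functionals on a finite-dimensional space is not norm separated. -/
theorem exists_lt_norm_apply_sub_lt {𝕜 E : Type*} [RCLike 𝕜] [NormedAddCommGroup E]
    [NormedSpace 𝕜 E] [FiniteDimensional 𝕜 E] (g : ℕ → E →L[𝕜] 𝕜)
    (hg : ∀ k v, ‖g k v‖ ≤ ‖v‖) {ε : ℝ} (hε : 0 < ε) :
    ∃ i j, i < j ∧ ∀ v, ‖v‖ ≤ 1 → ‖g j v - g i v‖ < ε := by
  have : ProperSpace (E →L[𝕜] 𝕜) := FiniteDimensional.proper_rclike 𝕜 _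
  obtain ⟨L, -, φ, hφ, hlim⟩ := (isCompact_closedBall (0 : E →L[𝕜] 𝕜) 1).tendsto_subseq
    (x := g) (fun k => by
      rw [mem_closedBall_zero_iff]
      refine ContinuousLinearMap.opNorm_le_bound _ zero_le_one fun v => ?_
      rw [one_mul]
      exact hg k v)
  obtain ⟨N, hN⟩ := Metric.cauchySeq_iff.1 hlim.cauchySeq ε hε
  refine ⟨φ N, φ (N + 1), hφ (Nat.lt_succ_self N), fun v hv => ?_⟩
  have h1 := hN (N + 1) (Nat.le_succ N) N le_rfl
  rw [dist_eq_norm] at h1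
  exact (((g (φ (N + 1)) - g (φ N)).le_opNorm v).trans
    (mul_le_of_le_one_right (norm_nonneg _) hv)).trans_lt h1

theorem exists_infinite_inter_preannihilator {𝕜 X : Type*} [RCLike 𝕜] [NormedAddCommGroup X]
    [NormedSpace 𝕜 X] (x : ℕ → X) (hx : ∀ n, ‖x n‖ ≤ 1)
    (hnt : ¬ TotallyBounded (Set.range x)) :
    ∃ Y : Submodule 𝕜 (StrongDual 𝕜 X), IsClosed (Y : Set (StrongDual 𝕜 X)) ∧
      ¬ FiniteDimensional 𝕜 Y ∧ (Set.range x ∩ (preannihilator Y : Set X)).Infinite := by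
  obtain ⟨n, c, hc, hsep⟩ := exists_uniformly_minimal_subseq (𝕜 := 𝕜) x hx hnt
  have hinj : Function.Injective (x ∘ n) := by
    intro i j hij
    by_contra hne
    have h1 := hsep j (x (n i)) (Submodule.subset_span ⟨i, hne, rfl⟩)
    rw [← show x (n i) = x (n j) from hij, sub_self, norm_zero] at h1
    linarith
  let A : Set X := Set.range fun k => x (n (2 * k))
  refine ⟨dualAnnihilatorOfSet 𝕜 A, isClosed_dualAnnihilatorOfSet 𝕜 A, fun hfd => ?_, ?_⟩
  -- Evaluations at the odd-indexed terms: on a finite-dimensional annihilator two of them would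
  -- differ by less than `c` on the unit ball.
  · obtain ⟨i, j, hij, hlt⟩ := exists_lt_norm_apply_sub_lt (E := dualAnnihilatorOfSet 𝕜 A)
      (fun k => (ContinuousLinearMap.apply 𝕜 𝕜 (x (n (2 * k + 1)))).comp
        (dualAnnihilatorOfSet 𝕜 A).subtypeL)
      (fun k f => ((f : StrongDual 𝕜 X).le_opNorm _).trans
        (mul_le_of_le_one_right (norm_nonneg _) (hx _))) hc
    obtain ⟨f, hf, hf1, hfc⟩ := exists_mem_dualAnnihilatorOfSet (𝕜 := 𝕜) A
      (v := x (n (2 * j + 1)) - x (n (2 * i + 1))) (c := c) (fun s hs => by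
        rw [sub_sub]
        refine hsep (2 * j + 1) _ (Submodule.add_mem _ (Submodule.subset_span
          ⟨2 * i + 1, by simp only [Set.mem_compl_iff, Set.mem_singleton_iff]; omega, rfl⟩)
          (Submodule.span_mono ?_ hs))
        rintro _ ⟨k, rfl⟩
        exact ⟨2 * k, by simp only [Set.mem_compl_iff, Set.mem_singleton_iff]; omega, rfl⟩)
    rw [map_sub] at hfc
    exact absurd (hlt ⟨f, hf⟩ hf1) (not_lt.2 hfc)
  · refine (Set.infinite_range_of_injective (f := fun k => x (n (2 * k))) fun a b hab => ?_).mono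
      ?_
    · have := hinj (show (x ∘ n) (2 * a) = (x ∘ n) (2 * b) from hab)
      omega
    · rintro _ ⟨k, rfl⟩
      exact ⟨⟨_, rfl⟩, fun f hf => hf _ ⟨k, rfl⟩⟩

theorem not_isCompact_closure_range_of_separated {X : Type*} [PseudoMetricSpace X]
    (x : ℕ → X) {δ : ℝ} (hδ : 0 < δ) (h : ∀ m n, m ≠ n → δ ≤ dist (x m) (x n)) :
    ¬ IsCompact (closure (Set.range x)) := by
  intro hK
  obtain ⟨_, -, φ, hφ, hlim⟩ := hK.tendsto_subseq fun n => subset_closure (Set.mem_range_self n)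
  obtain ⟨N, hN⟩ := Metric.cauchySeq_iff.1 hlim.cauchySeq δ hδ
  have h1 := hN (N + 1) (Nat.le_succ N) N le_rfl
  exact absurd h1 (not_lt.2 (h _ _ (hφ.injective.ne (Nat.succ_ne_self N))))

theorem corollary2p2 {𝕜 X : Type*} [RCLike 𝕜] [NormedAddCommGroup X] [NormedSpace 𝕜 X]
    [CompleteSpace X] (x : ℕ → X) (hx : ∀ n, x n ∈ Metric.closedBall (0 : X) 1) :
    (¬ IsCompact (closure (Set.range x)) →
      ∃ Y : Submodule 𝕜 (StrongDual 𝕜 X), IsClosed (Y : Set (StrongDual 𝕜 X)) ∧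
        ¬ FiniteDimensional 𝕜 Y ∧
        (Set.range x ∩ (preannihilator Y : Set X)).Infinite) ∧
    (∀ δ : ℝ, 0 < δ → (∀ m n, m ≠ n → δ ≤ ‖x m - x n‖) →
      ∃ Y : Submodule 𝕜 (StrongDual 𝕜 X), IsClosed (Y : Set (StrongDual 𝕜 X)) ∧
        ¬ FiniteDimensional 𝕜 Y ∧
        (Set.range x ∩ (preannihilator Y : Set X)).Infinite) := by
  have hx1 : ∀ n, ‖x n‖ ≤ 1 := fun n => mem_closedBall_zero_iff.1 (hx n)
  have main : ¬ IsCompact (closure (Set.range x)) →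
      ∃ Y : Submodule 𝕜 (StrongDual 𝕜 X), IsClosed (Y : Set (StrongDual 𝕜 X)) ∧
        ¬ FiniteDimensional 𝕜 Y ∧ (Set.range x ∩ (preannihilator Y : Set X)).Infinite :=
    -- Completeness of `X` enters only here, to make a closed totally bounded set compact.
    fun h => exists_infinite_inter_preannihilator x hx1 fun ht =>
      h (ht.closure.isCompact_of_isClosed isClosed_closure)
  refine ⟨main, fun δ hδ hsep => main ?_⟩
  exact not_isCompact_closure_range_of_separated x hδ fun m n hmn => by
    rw [dist_eq_norm]
    exact hsep m n hmn
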